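/- Let $0\le k\le n$ be integers, let $B^m=\{z\in\mathbb C^m:|z|<1\}$ denote the Euclidean unit ball, let $\operatorname{Aut}(B^m)$ be the group of biholomorphic maps of $B^m$ onto itself, and let $\operatorname{SU}_{m,1}$ be the group of complex $(m+1)\times(m+1)$ matrices $M$ with $\overline{M}^{t} I_{m,1} M = I_{m,1}$ and $\det M=1$, where $I_{m,1}=\operatorname{diag}(1,\dots,1,-1)$. Let $F=(F_1,\dots,F_n)\in\operatorname{Aut}(B^n)$ be such that $$F\bigl(B^n\cap\{z_i=0\}\bigr)\subset\{z_i=0\}\qquad\text{for all } n-k+1\le i\le n .$$ Then there are a matrix $A=(A_j^\ell)\in\mathbb C^{(n-k)\times(n-k)}$ ($j$ the row index, $\ell$ the column index), a column $b=(b_j)\in\mathbb C^{n-k}$, a row $c=(c^\ell)\in\mathbb C^{n-k}$, a number $d\in\mathbb C$ and real numbers $\theta_j$ ($n-k+1\le j\le n$) such that $$\begin{pmatrix}A&b\\ c&d\end{pmatrix}\in\operatorname{SU}_{n-k,1},\qquad \sum_{\ell=1}^{n-k}c^\ell z_\ell+d\neq0\quad\text{for every } z\in B^n,$$ and, for every $z\in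 B^n$, $$F_j(z)=\frac{\sum_{\ell=1}^{n-k}A_j^\ell z_\ell+b_j}{\sum_{\ell=1}^{n-k}c^\ell z_\ell+d}\quad(1\le j\le n-k),\qquad F_j(z)=e^{i\theta_j}z_j\,\frac{1}{\sum_{\ell=1}^{n-k}c^\ell z_\ell+d}\quad(n-k+1\le j\le n).$$ In particular, $F_1,\dots,F_{n-k}$ depend only on $(z_1,\dots,z_{n-k})$ and coincide with the components of an element of $\operatorname{Aut}(B^{n-k})$: the linear-fractional map $w\mapsto (Aw+b)/(\sum_{\ell} c^\ell w_\ell+d)$ is an automorphism $\Phi$ of $B^{n-k}$, and $F_j(z)=\Phi_j(z_1,\dots,z_{n-k})$ for all $z\in B^n$ and $1\le j\le n-k$. -/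

import Mathlib

/-- The open unit ball `B^n` of `ℂ^n` (Euclidean norm). -/
def unitBall (n : ℕ) : Set (EuclideanSpace ℂ (Fin n)) := Metric.ball 0 1

/-- `F` restricts to a biholomorphic automorphism of `B^n`: it is a holomorphic self-map of
`B^n` with a holomorphic two-sided inverse. The values of `F` outside `B^n` play no role. -/
def IsBallAut {n : ℕ} (F : EuclideanSpace ℂ (Fin n) → EuclideanSpace ℂ (Fin n)) : Prop :=
  Set.MapsTo F (unitBall n) (unitBall n) ∧ DifferentiableOn ℂ F (unitBall n) ∧
    ∃ G : EuclideanSpace ℂ (Fin n) → EuclideanSpace ℂ (Fin n),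
      Set.MapsTo G (unitBall n) (unitBall n) ∧ DifferentiableOn ℂ G (unitBall n) ∧
        Set.InvOn G F (unitBall n) (unitBall n)

/-- The matrix `I_{m,1} = diag(1, …, 1, -1)` of size `m + 1`. -/
def indefI (m : ℕ) : Matrix (Fin m ⊕ Unit) (Fin m ⊕ Unit) ℂ :=
  Matrix.fromBlocks 1 0 0 (-1)

/-- The set `SU_{m,1}` of matrices `M` with `M̄ᵗ I_{m,1} M = I_{m,1}` and `det M = 1`. -/
def SUm1 (m : ℕ) : Set (Matrix (Fin m ⊕ Unit) (Fin m ⊕ Unit) ℂ) :=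
  {M | M.conjTranspose * indefI m * M = indefI m ∧ M.det = 1}

/-- The block matrix with rows `(A, b)` and `(c, d)`. -/
def bordered {m : ℕ} (A : Matrix (Fin m) (Fin m) ℂ) (b c : Fin m → ℂ) (d : ℂ) :
    Matrix (Fin m ⊕ Unit) (Fin m ⊕ Unit) ℂ :=
  Matrix.fromBlocks A (Matrix.replicateCol Unit b) (Matrix.replicateRow Unit c)
    (Matrix.of fun _ _ => d)

/-- The index of one of the first `n - k` coordinates, as an index of a coordinate of `ℂ^n`. -/
def firstIdx (n k : ℕ) (j : Fin (n - k)) : Fin n := Fin.castLE (Nat.sub_le n k) j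

/-- The projection `(z_1, …, z_n) ↦ (z_1, …, z_{n-k})`. -/
noncomputable def firstCoords (n k : ℕ) (z : EuclideanSpace ℂ (Fin n)) :
    EuclideanSpace ℂ (Fin (n - k)) :=
  WithLp.toLp 2 fun l => z (firstIdx n k l)

open Matrix Metric Set

/-! Every automorphism of the ball is linear-fractional with a matrix `M` in `U_{n,1}`. Precompose
`F` with a Möbius map taking `0` to `F⁻¹(0)`. The result `H` fixes `0`, so the Schwarz lemma for `H`
and for its inverse gives `‖H z‖ = ‖z‖`. The equality case on complex lines through `0` makes `H`
linear, hence unitary (`IsBallAut.exists_eqOn_linFrac`).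

The hypothesis on `{z_i = 0}` then becomes linear algebra. The numerator of `F_i` vanishes on that
slice, so row `i` of `M` has only its diagonal entry (`PreservesForm.row_eq_zero`). With `J = indefI
n`, the relation `M J Mᴴ = J` makes this entry unimodular and kills the rest of column `i`. So `M`
splits into a `U_{n-k,1}` block and `k` phases. Multiplying `M` by a phase `μ` does not change the
map; `μ` is chosen to give the block determinant `1`, and it is absorbed into the `θ_j`. -/

/-- Homogeneous coordinates `(z, 1)` of a point `z` of `ℂ^n`. -/
def homog {n : ℕ} (z : EuclideanSpace ℂ (Fin n)) : Fin n ⊕ Unit → ℂ :=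
  Sum.elim (fun i => z i) fun _ => 1

/-- The linear-fractional map with homogeneous matrix `M`. -/
noncomputable def linFrac {n : ℕ} (M : Matrix (Fin n ⊕ Unit) (Fin n ⊕ Unit) ℂ)
    (z : EuclideanSpace ℂ (Fin n)) : EuclideanSpace ℂ (Fin n) :=
  WithLp.toLp 2 fun j => (M *ᵥ homog z) (Sum.inl j) / (M *ᵥ homog z) (Sum.inr ())

/-- `M` belongs to `U_{n,1}`. -/
def PreservesForm {n : ℕ} (M : Matrix (Fin n ⊕ Unit) (Fin n ⊕ Unit) ℂ) : Prop :=
  Mᴴ * indefI n * M = indefI n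

/-! ### The group `U_{n,1}` and its action on the ball -/

theorem mulVec_homog_apply {n : ℕ} (M : Matrix (Fin n ⊕ Unit) (Fin n ⊕ Unit) ℂ)
    (z : EuclideanSpace ℂ (Fin n)) (r : Fin n ⊕ Unit) :
    (M *ᵥ homog z) r = (∑ l, M r (Sum.inl l) * z l) + M r (Sum.inr ()) := by
  simp [Matrix.mulVec, dotProduct, homog]

theorem indefI_mul_self (n : ℕ) : indefI n * indefI n = 1 := by
  simp [indefI, Matrix.fromBlocks_multiply]

theorem indefI_conjTranspose (n : ℕ) : (indefI n)ᴴ = indefI n := by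
  simp [indefI, Matrix.fromBlocks_conjTranspose]

theorem indefI_form {n : ℕ} (v : Fin n ⊕ Unit → ℂ) :
    star v ⬝ᵥ (indefI n *ᵥ v) =
      (((∑ j, ‖v (Sum.inl j)‖ ^ 2) - ‖v (Sum.inr ())‖ ^ 2 : ℝ) : ℂ) := by
  have h : indefI n *ᵥ v = Sum.elim (fun j => v (Sum.inl j)) (fun u => - v (Sum.inr u)) := by
    ext (i | i) <;>
      simp [indefI, Matrix.mulVec, dotProduct, Matrix.one_apply]
  simp only [h, dotProduct, Fintype.sum_sum_type, Pi.star_apply, Sum.elim_inl, Sum.elim_inr,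
    Finset.univ_unique, Finset.sum_singleton, RCLike.star_def, mul_neg, Complex.conj_mul']
  push_cast
  rfl

namespace PreservesForm

variable {n : ℕ} {M N : Matrix (Fin n ⊕ Unit) (Fin n ⊕ Unit) ℂ}

theorem mul (hM : PreservesForm M) (hN : PreservesForm N) : PreservesForm (M * N) := by
  unfold PreservesForm at *
  calc (M * N)ᴴ * indefI n * (M * N) = Nᴴ * (Mᴴ * indefI n * M) * N := by
        simp only [conjTranspose_mul, Matrix.mul_assoc]
    _ = indefI n := by rw [hM, hN]

theorem inverse_mul (hM : PreservesForm M) : (indefI n * Mᴴ * indefI n) * M = 1 := by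
  unfold PreservesForm at hM
  calc (indefI n * Mᴴ * indefI n) * M = indefI n * (Mᴴ * indefI n * M) := by
        simp only [Matrix.mul_assoc]
    _ = 1 := by rw [hM, indefI_mul_self]

theorem mul_inverse (hM : PreservesForm M) : M * (indefI n * Mᴴ * indefI n) = 1 :=
  mul_eq_one_comm.mp hM.inverse_mul

/-- Orthogonality of the rows, as opposed to the columns: this is what turns knowledge of a row into
knowledge of a column. -/
theorem mul_conjTranspose (hM : PreservesForm M) : M * indefI n * Mᴴ = indefI n := by
  calc M * indefI n * Mᴴ = (M * (indefI n * Mᴴ * indefI n)) * indefI n := by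
        simp only [Matrix.mul_assoc, indefI_mul_self, Matrix.mul_one]
    _ = indefI n := by rw [hM.mul_inverse, Matrix.one_mul]

theorem inverse (hM : PreservesForm M) : PreservesForm (indefI n * Mᴴ * indefI n) := by
  have h := hM.mul_conjTranspose
  unfold PreservesForm
  simp only [conjTranspose_mul, conjTranspose_conjTranspose, indefI_conjTranspose]
  calc indefI n * (M * indefI n) * indefI n * (indefI n * Mᴴ * indefI n)
      = indefI n * (M * (indefI n * (indefI n * indefI n)) * Mᴴ) * indefI n := by
        simp only [Matrix.mul_assoc]
    _ = indefI n := by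
        rw [indefI_mul_self, Matrix.mul_one, h, indefI_mul_self, Matrix.one_mul]

theorem smul (hM : PreservesForm M) {c : ℂ} (hc : ‖c‖ = 1) : PreservesForm (c • M) := by
  have h : c * (starRingEnd ℂ) c = 1 := by simp [Complex.mul_conj', hc]
  unfold PreservesForm at *
  simp [conjTranspose_smul, hM, smul_smul, h]

theorem norm_det (hM : PreservesForm M) : ‖M.det‖ = 1 := by
  have hJ : (indefI n).det ≠ 0 := by
    intro h
    simpa [h] using congrArg Matrix.det (indefI_mul_self n)
  have h : star M.det * M.det = 1 := by
    have := congrArg Matrix.det hM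
    rw [det_mul, det_mul, det_conjTranspose] at this
    apply mul_right_cancel₀ hJ
    linear_combination this
  have h2 : ‖M.det‖ ^ 2 = 1 := by
    rw [RCLike.star_def, Complex.conj_mul'] at h
    exact_mod_cast h
  exact (pow_eq_one_iff_of_nonneg (norm_nonneg _) two_ne_zero).1 h2

theorem form_mulVec (hM : PreservesForm M) (v : Fin n ⊕ Unit → ℂ) :
    (∑ j, ‖(M *ᵥ v) (Sum.inl j)‖ ^ 2) - ‖(M *ᵥ v) (Sum.inr ())‖ ^ 2 =
      (∑ j, ‖v (Sum.inl j)‖ ^ 2) - ‖v (Sum.inr ())‖ ^ 2 := by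
  have h : star (M *ᵥ v) ⬝ᵥ (indefI n *ᵥ (M *ᵥ v)) = star v ⬝ᵥ (indefI n *ᵥ v) := by
    rw [star_mulVec, ← dotProduct_mulVec, mulVec_mulVec, mulVec_mulVec, hM]
  rw [indefI_form, indefI_form] at h
  exact_mod_cast h

theorem form_mulVec_homog (hM : PreservesForm M) (z : EuclideanSpace ℂ (Fin n)) :
    (∑ j, ‖(M *ᵥ homog z) (Sum.inl j)‖ ^ 2) - ‖(M *ᵥ homog z) (Sum.inr ())‖ ^ 2 =
      ‖z‖ ^ 2 - 1 := by
  rw [hM.form_mulVec, EuclideanSpace.norm_sq_eq]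
  simp [homog]

/-- Otherwise the form at `M (z, 1)` would be a sum of squares, while it equals `‖z‖ ^ 2 - 1 < 0`.
-/
theorem denom_ne_zero (hM : PreservesForm M) {z : EuclideanSpace ℂ (Fin n)}
    (hz : z ∈ unitBall n) : (M *ᵥ homog z) (Sum.inr ()) ≠ 0 := by
  intro h
  have h1 := hM.form_mulVec_homog z
  have hz' : ‖z‖ < 1 := by simpa [unitBall] using hz
  have h2 : 0 ≤ ∑ j, ‖(M *ᵥ homog z) (Sum.inl j)‖ ^ 2 := by positivity
  rw [h] at h1
  nlinarith [norm_nonneg z, norm_zero (E := ℂ)]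

theorem mapsTo_linFrac (hM : PreservesForm M) :
    MapsTo (linFrac M) (unitBall n) (unitBall n) := by
  intro z hz
  have hd : 0 < ‖(M *ᵥ homog z) (Sum.inr ())‖ := norm_pos_iff.2 (hM.denom_ne_zero hz)
  have h1 := hM.form_mulVec_homog z
  have hz' : ‖z‖ < 1 := by simpa [unitBall] using hz
  have h2 : ‖linFrac M z‖ ^ 2 < 1 := by
    rw [EuclideanSpace.norm_sq_eq]
    simp only [linFrac, norm_div, div_pow, ← Finset.sum_div]
    rw [div_lt_one (by positivity)]
    nlinarith [norm_nonneg z]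
  have : ‖linFrac M z‖ < 1 := by nlinarith [norm_nonneg (linFrac M z)]
  simpa [unitBall] using this

theorem differentiableOn_linFrac (hM : PreservesForm M) :
    DifferentiableOn ℂ (linFrac M) (unitBall n) := by
  rw [differentiableOn_euclidean]
  intro j
  simp only [linFrac]
  have h : ∀ r, Differentiable ℂ fun z : EuclideanSpace ℂ (Fin n) => (M *ᵥ homog z) r := by
    intro r
    simp only [mulVec_homog_apply]
    fun_prop
  simp only [div_eq_mul_inv]
  exact (h _).differentiableOn.mul ((h _).differentiableOn.inv fun z hz => hM.denom_ne_zero hz)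

/-- Homogeneous coordinates of the image are a nonzero multiple of `N (z, 1)`, and the multiple
cancels in the quotient. -/
theorem linFrac_linFrac (hN : PreservesForm N) {z : EuclideanSpace ℂ (Fin n)}
    (hz : z ∈ unitBall n) : linFrac M (linFrac N z) = linFrac (M * N) z := by
  have hd := hN.denom_ne_zero hz
  have h : homog (linFrac N z) = ((N *ᵥ homog z) (Sum.inr ()))⁻¹ • (N *ᵥ homog z) := by
    ext (i | i)
    · simp [homog, linFrac, div_eq_inv_mul]
    · exact (inv_mul_cancel₀ hd).symm
  ext j
  rw [linFrac, h]
  simp only [linFrac, mulVec_smul, mulVec_mulVec, Pi.smul_apply, smul_eq_mul]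
  rw [mul_div_mul_left _ _ (inv_ne_zero hd)]

theorem linFrac_one (z : EuclideanSpace ℂ (Fin n)) : linFrac 1 z = z := by
  ext j
  simp [linFrac, homog]

theorem isBallAut_linFrac (hM : PreservesForm M) : IsBallAut (linFrac M) := by
  refine ⟨hM.mapsTo_linFrac, hM.differentiableOn_linFrac, linFrac (indefI n * Mᴴ * indefI n),
    hM.inverse.mapsTo_linFrac, hM.inverse.differentiableOn_linFrac, fun z hz => ?_, fun z hz => ?_⟩
  · rw [hM.linFrac_linFrac hz, hM.inverse_mul, linFrac_one]
  · rw [hM.inverse.linFrac_linFrac hz, hM.mul_inverse, linFrac_one]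

end PreservesForm

/-- `U_{n,1}` acts transitively on the ball. -/
theorem exists_preservesForm_linFrac_eq_zero {n : ℕ} {a : EuclideanSpace ℂ (Fin n)}
    (ha : a ∈ unitBall n) : ∃ M, PreservesForm M ∧ linFrac M a = 0 := by
  have ha' : ‖a‖ < 1 := by simpa [unitBall] using ha
  have hpos : 0 < 1 - ‖a‖ ^ 2 := by nlinarith [norm_nonneg a]
  obtain ⟨s, hs, hs2⟩ : ∃ s : ℝ, 0 < s ∧ s ^ 2 = 1 - ‖a‖ ^ 2 :=
    ⟨√(1 - ‖a‖ ^ 2), Real.sqrt_pos.2 hpos, Real.sq_sqrt hpos.le⟩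
  have hsC : (s : ℂ) ≠ 0 := by exact_mod_cast hs.ne'
  have hs1 : (1 + s : ℂ) ≠ 0 := by exact_mod_cast (by positivity : (1 + s : ℝ) ≠ 0)
  have hsum : ∑ l, (starRingEnd ℂ) (a l) * a l = 1 - (s : ℂ) ^ 2 := by
    simp only [Complex.conj_mul']
    have : ∑ l, ‖a l‖ ^ 2 = 1 - s ^ 2 := by rw [← EuclideanSpace.norm_sq_eq, hs2]; ring
    exact_mod_cast this
  -- `M₀` is the usual Möbius involution exchanging `a` and `0`. The coefficient `(1 + s)⁻¹` equals
  -- `(1 - s) / ‖a‖ ^ 2` for `a ≠ 0` and needs no separate case at `a = 0`. `M₀` scales the form by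
  -- `s ^ 2`, whence the final factor `s⁻¹`.
  let A : Matrix (Fin n) (Fin n) ℂ :=
    -((s : ℂ) • 1 + (1 + s : ℂ)⁻¹ • vecMulVec (fun i => a i) (star fun i => a i))
  let M₀ : Matrix (Fin n ⊕ Unit) (Fin n ⊕ Unit) ℂ :=
    fromBlocks A (replicateCol Unit fun i => a i) (replicateRow Unit (-star fun i => a i)) 1
  have hdot : (star fun i => a i) ⬝ᵥ (fun i => a i) = 1 - (s : ℂ) ^ 2 := hsum
  have hAH : Aᴴ = A := by
    simp [A, conjTranspose_vecMulVec]
  have hAa : A *ᵥ (fun i => a i) = - fun i => a i := by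
    simp only [A, neg_mulVec, add_mulVec, smul_mulVec, one_mulVec, vecMulVec_mulVec, hdot]
    ext i
    simp
    field_simp
    ring
  have hM₀ : M₀ᴴ * indefI n * M₀ = ((s : ℂ) ^ 2) • indefI n := by
    have hvA : (star fun i => a i) ᵥ* A = -star fun i => a i := by
      simpa [star_mulVec, hAH] using congrArg star hAa
    have hAA : A * A = ((s : ℂ) ^ 2) • 1 + vecMulVec (fun i => a i) (star fun i => a i) := by
      simp only [A, neg_mul_neg, Matrix.add_mul, Matrix.mul_add, smul_mul_smul_comm,
        vecMulVec_mul_vecMulVec, hdot, Matrix.mul_one, Matrix.one_mul]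
      ext i j
      simp [vecMulVec_apply, Matrix.one_apply]
      field_simp
      ring
    rw [indefI, fromBlocks_conjTranspose, fromBlocks_multiply, fromBlocks_multiply,
      fromBlocks_smul]
    simp only [hAH]
    congr 1
    · simp
      rw [hAA]
      ext i j
      simp [vecMulVec_apply, Matrix.mul_apply]
    · ext i j
      have := congrFun hAa i
      simp [mulVec, dotProduct] at this
      simp [Matrix.mul_apply, this]
    · ext i j
      have := congrFun hvA j
      simp [vecMul, dotProduct] at this
      simp [Matrix.mul_apply, this]
    · ext i j
      simp [Matrix.mul_apply, hsum]
      ring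
  refine ⟨(s : ℂ)⁻¹ • M₀, ?_, ?_⟩
  · unfold PreservesForm
    simp [conjTranspose_smul, hM₀, smul_smul]
    field_simp
    simp
  · ext j
    have : (M₀ *ᵥ homog a) (Sum.inl j) = 0 := by
      have := congrFun hAa j
      simp [mulVec_homog_apply, M₀]
      simp [mulVec, dotProduct] at this
      simp [this]
    simp [linFrac, smul_mulVec, this]

/-! ### Schwarz lemma and linearity of automorphisms fixing the origin -/

/-- A holomorphic norm-preserving map of the unit ball is the restriction of its derivative. -/
theorem eqOn_fderiv_of_norm_eq {E F : Type*} [NormedAddCommGroup E] [NormedSpace ℂ E]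
    [NormedAddCommGroup F] [NormedSpace ℂ F] [StrictConvexSpace ℝ F] {f : E → F}
    (hd : DifferentiableOn ℂ f (ball 0 1)) (hn : ∀ z ∈ ball (0 : E) 1, ‖f z‖ = ‖z‖) :
    EqOn f (fderiv ℂ f 0) (ball 0 1) := by
  have h0 : f 0 = 0 := by simpa using hn 0 (by simp)
  intro z hz
  rcases eq_or_ne z 0 with rfl | hz0
  · simp [h0]
  have hnz : ‖z‖ ≠ 0 := norm_ne_zero_iff.2 hz0
  have hnzC : (‖z‖ : ℂ) ≠ 0 := by exact_mod_cast hnz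
  have hz1 : ‖z‖ < 1 := by simpa using hz
  set u : E := (‖z‖ : ℂ)⁻¹ • z with hu
  have hun : ‖u‖ = 1 := by simp [hu, norm_smul, hnz]
  have hzu : z = (‖z‖ : ℂ) • u := by rw [hu, smul_inv_smul₀ hnzC]
  have hmem : ∀ t ∈ ball (0 : ℂ) 1, t • u ∈ ball (0 : E) 1 := by
    intro t ht
    simpa [norm_smul, hun] using ht
  let g : ℂ → F := fun t => f (t • u)
  have hg0 : g 0 = 0 := by simp [g, h0]
  have hgn : ∀ t ∈ ball (0 : ℂ) 1, ‖g t‖ = ‖t‖ := by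
    intro t ht
    simp [g, hn _ (hmem t ht), norm_smul, hun]
  have hgd : DifferentiableOn ℂ g (ball 0 1) :=
    hd.comp (by fun_prop) hmem
  have hgm : MapsTo g (ball 0 1) (closedBall (g 0) 1) := by
    intro t ht
    have := hgn t ht
    simp only [mem_ball_zero_iff] at ht
    simp [hg0, this, ht.le]
  have hzm : (‖z‖ : ℂ) ∈ ball (0 : ℂ) 1 := by simpa using hz1
  -- Equality case of the Schwarz lemma on the slice `t ↦ f (t • u)`: the slope at `‖z‖` has norm
  -- `1`. Strict convexity of the target makes the slice linear.
  obtain ⟨C, -, hC⟩ := Complex.affine_of_mapsTo_ball_of_exists_norm_dslope_eq_div' hgd hgm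
    ⟨(‖z‖ : ℂ), hzm, by
      rw [dslope_of_ne _ hnzC, slope_def_module, hg0, sub_zero, sub_zero, norm_smul, norm_inv,
        hgn _ hzm]
      simp [hnz]⟩
  have hC' : EqOn g (fun t => t • C) (ball 0 1) := fun t ht => by simpa [hg0] using hC ht
  have hder : HasDerivAt g (fderiv ℂ f 0 u) 0 := by
    have hf : HasFDerivAt f (fderiv ℂ f 0) ((0 : ℂ) • u) := by
      rw [zero_smul]
      exact (hd.differentiableAt (ball_mem_nhds 0 one_pos)).hasFDerivAt
    have hl : HasDerivAt (fun t : ℂ => t • u) u 0 := by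
      simpa using (hasDerivAt_id (0 : ℂ)).smul_const u
    exact hf.comp_hasDerivAt 0 hl
  have hder' : HasDerivAt g C 0 := by
    have hl : HasDerivAt (fun t : ℂ => t • C) C 0 := by
      simpa using (hasDerivAt_id (0 : ℂ)).smul_const C
    exact hl.congr_of_eventuallyEq (hC'.eventuallyEq_of_mem (ball_mem_nhds 0 one_pos))
  have hCu : fderiv ℂ f 0 u = C := hder.unique hder'
  calc f z = g ‖z‖ := by rw [hzu]; simp [g, norm_smul, hun]
    _ = (‖z‖ : ℂ) • C := hC' hzm
    _ = fderiv ℂ f 0 z := by conv_rhs => rw [hzu, map_smul, hCu]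

/-- A linear map that preserves norms on the unit ball preserves them everywhere. -/
theorem norm_map_of_norm_map_ball {E F : Type*} [NormedAddCommGroup E] [NormedSpace ℂ E]
    [NormedAddCommGroup F] [NormedSpace ℂ F] (L : E →L[ℂ] F)
    (h : ∀ z ∈ ball (0 : E) 1, ‖L z‖ = ‖z‖) (z : E) : ‖L z‖ = ‖z‖ := by
  have hp : 0 < 1 + ‖z‖ := by positivity
  have h1 := h (((1 + ‖z‖ : ℝ) : ℂ)⁻¹ • z) (by
    rw [mem_ball_zero_iff, norm_smul, norm_inv, Complex.norm_real, Real.norm_of_nonneg hp.le,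
      inv_mul_lt_iff₀ hp]
    linarith)
  rw [map_smul, norm_smul, norm_smul] at h1
  refine mul_left_cancel₀ ?_ h1
  simpa using (by exact_mod_cast hp.ne' : ((1 + ‖z‖ : ℝ) : ℂ) ≠ 0)

/-- A norm-preserving linear map is linear-fractional with matrix in `U_{n,1}`. -/
theorem exists_preservesForm_eq_linFrac_of_norm_map {n : ℕ}
    (L : EuclideanSpace ℂ (Fin n) →L[ℂ] EuclideanSpace ℂ (Fin n)) (hL : ∀ z, ‖L z‖ = ‖z‖) :
    ∃ M, PreservesForm M ∧ ∀ z, L z = linFrac M z := by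
  let U : Matrix (Fin n) (Fin n) ℂ := Matrix.of fun i j => L (EuclideanSpace.single j 1) i
  have hU : Uᴴ * U = 1 := by
    let L' : EuclideanSpace ℂ (Fin n) →ₗᵢ[ℂ] EuclideanSpace ℂ (Fin n) := ⟨L.toLinearMap, hL⟩
    ext i j
    have h := L'.inner_map_map (EuclideanSpace.single i (1 : ℂ)) (EuclideanSpace.single j (1 : ℂ))
    simp only [PiLp.inner_apply] at h
    simpa [Matrix.mul_apply, U, L', Matrix.one_apply, mul_comm, Pi.single_apply, eq_comm] using h
  refine ⟨fromBlocks U 0 0 1, ?_, fun z => ?_⟩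
  · simp [PreservesForm, indefI, fromBlocks_conjTranspose, fromBlocks_multiply, hU]
  · have hz : z = ∑ l, z l • EuclideanSpace.single l (1 : ℂ) := by
      ext i
      simp [Pi.single_apply]
    ext j
    conv_lhs => rw [hz]
    simp [linFrac, mulVec_homog_apply, U, mul_comm]

/-- Every automorphism of the ball is linear-fractional with matrix in `U_{n,1}`. -/
theorem IsBallAut.exists_eqOn_linFrac {n : ℕ}
    {F : EuclideanSpace ℂ (Fin n) → EuclideanSpace ℂ (Fin n)} (hF : IsBallAut F) :
    ∃ M, PreservesForm M ∧ EqOn F (linFrac M) (unitBall n) := by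
  obtain ⟨hFm, hFd, G, hGm, hGd, hGF, hFG⟩ := hF
  have h0 : (0 : EuclideanSpace ℂ (Fin n)) ∈ unitBall n := by simp [unitBall]
  obtain ⟨T, hT, hTa⟩ := exists_preservesForm_linFrac_eq_zero (hGm h0)
  set S := indefI n * Tᴴ * indefI n
  have hS : PreservesForm S := hT.inverse
  have hST : ∀ z ∈ unitBall n, linFrac S (linFrac T z) = z := fun z hz => by
    rw [hT.linFrac_linFrac hz, hT.inverse_mul, PreservesForm.linFrac_one]
  have hTS : ∀ z ∈ unitBall n, linFrac T (linFrac S z) = z := fun z hz => by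
    rw [hS.linFrac_linFrac hz, hT.mul_inverse, PreservesForm.linFrac_one]
  have hS0 : linFrac S 0 = G 0 := by simpa [hTa] using hST _ (hGm h0)
  let H := F ∘ linFrac S
  let K := linFrac T ∘ G
  have hHm : MapsTo H (unitBall n) (unitBall n) := hFm.comp hS.mapsTo_linFrac
  have hKm : MapsTo K (unitBall n) (unitBall n) := hT.mapsTo_linFrac.comp hGm
  have hHd : DifferentiableOn ℂ H (unitBall n) :=
    hFd.comp hS.differentiableOn_linFrac hS.mapsTo_linFrac
  have hKd : DifferentiableOn ℂ K (unitBall n) := hT.differentiableOn_linFrac.comp hGd hGm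
  have hH0 : H 0 = 0 := by simp [H, hS0, hFG h0]
  have hK0 : K 0 = 0 := by simp [K, hTa]
  have hKH : ∀ z ∈ unitBall n, K (H z) = z := fun z hz => by
    simp only [K, H, Function.comp_apply]
    rw [hGF (hS.mapsTo_linFrac hz), hTS z hz]
  -- `K` inverts `H` and also fixes `0`, so the Schwarz bound applies in both directions.
  have hn : ∀ z ∈ ball (0 : EuclideanSpace ℂ (Fin n)) 1, ‖H z‖ = ‖z‖ := by
    intro z hz
    refine le_antisymm ?_ ?_
    · exact Complex.norm_le_norm_of_mapsTo_ball hHd (hHm.mono_right ball_subset_closedBall) hH0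
        (mem_ball_zero_iff.1 hz)
    · calc ‖z‖ = ‖K (H z)‖ := by rw [hKH z hz]
        _ ≤ ‖H z‖ := Complex.norm_le_norm_of_mapsTo_ball hKd
          (hKm.mono_right ball_subset_closedBall) hK0 (mem_ball_zero_iff.1 (hHm hz))
  have hL := eqOn_fderiv_of_norm_eq hHd hn
  obtain ⟨V, hV, hVL⟩ := exists_preservesForm_eq_linFrac_of_norm_map (fderiv ℂ H 0)
    (norm_map_of_norm_map_ball _ fun z hz => by rw [← hL hz, hn z hz])
  refine ⟨V * T, hV.mul hT, fun z hz => ?_⟩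
  calc F z = H (linFrac T z) := by simp [H, hST z hz]
    _ = linFrac V (linFrac T z) := by rw [hL (hT.mapsTo_linFrac hz), hVL]
    _ = linFrac (V * T) z := hT.linFrac_linFrac hz

/-! ### Shape of a matrix preserving coordinate hyperplanes -/

/-- If the linear-fractional map of `M` preserves `{z_i = 0}`, then only the diagonal entry of
row `i` is nonzero. -/
theorem PreservesForm.row_eq_zero {n : ℕ} {M : Matrix (Fin n ⊕ Unit) (Fin n ⊕ Unit) ℂ}
    (hM : PreservesForm M) {i : Fin n} (h : ∀ z ∈ unitBall n, z i = 0 → linFrac M z i = 0)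
    {r : Fin n ⊕ Unit} (hr : r ≠ Sum.inl i) : M (Sum.inl i) r = 0 := by
  have hnum : ∀ z ∈ unitBall n, z i = 0 →
      (∑ l, M (Sum.inl i) (Sum.inl l) * z l) + M (Sum.inl i) (Sum.inr ()) = 0 := by
    intro z hz hzi
    have := h z hz hzi
    rw [← mulVec_homog_apply]
    exact (div_eq_zero_iff.1 this).resolve_right (hM.denom_ne_zero hz)
  have h0 : M (Sum.inl i) (Sum.inr ()) = 0 := by
    simpa using hnum 0 (by simp [unitBall]) (by simp)
  rcases r with l | u
  · have hl : i ≠ l := fun e => hr (by rw [e])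
    -- The origin has disposed of the constant term; the test point `e_l / 2` lies in the slice
    -- since `l ≠ i`, and isolates the coefficient of `z_l`.
    have := hnum (EuclideanSpace.single l (1 / 2 : ℂ)) (by simp [unitBall]; norm_num)
      (by simp [hl])
    simpa [h0, Pi.single_apply] using this
  · exact h0

theorem indefI_apply_of_ne {n : ℕ} {r s : Fin n ⊕ Unit} (h : r ≠ s) : indefI n r s = 0 := by
  rcases r with r | r <;> rcases s with s | s <;>
    simp_all [indefI]

theorem mul_indefI_mul_apply {n : ℕ} (M N : Matrix (Fin n ⊕ Unit) (Fin n ⊕ Unit) ℂ)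
    (r s : Fin n ⊕ Unit) :
    (M * indefI n * N) r s = ∑ t, M r t * indefI n t t * N t s := by
  rw [Matrix.mul_apply]
  refine Finset.sum_congr rfl fun t _ => ?_
  rw [Matrix.mul_apply, Finset.sum_eq_single t]
  · intro u _ hu
    rw [indefI_apply_of_ne hu, mul_zero]
  · simp

/-- Entry `(i, i)` of `M J Mᴴ = J` reduces to `|M_ii|² = 1`. -/
theorem PreservesForm.norm_diag_eq_one {n : ℕ} {M : Matrix (Fin n ⊕ Unit) (Fin n ⊕ Unit) ℂ}
    (hM : PreservesForm M) {i : Fin n} (h : ∀ r, r ≠ Sum.inl i → M (Sum.inl i) r = 0) :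
    ‖M (Sum.inl i) (Sum.inl i)‖ = 1 := by
  have h1 := congrFun (congrFun hM.mul_conjTranspose (Sum.inl i)) (Sum.inl i)
  rw [mul_indefI_mul_apply, Finset.sum_eq_single (Sum.inl i)
    (fun t _ ht => by rw [h t ht]; simp) (by simp)] at h1
  simp only [indefI, fromBlocks_apply₁₁, Matrix.one_apply_eq, mul_one, conjTranspose_apply,
    RCLike.star_def, Complex.mul_conj'] at h1
  exact (pow_eq_one_iff_of_nonneg (norm_nonneg _) two_ne_zero).1 (by exact_mod_cast h1)

/-- Entry `(r, i)` of `M J Mᴴ = J` reduces to `M_ri` times the conjugate of `M_ii`, and `M_ii ≠ 0`.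
-/
theorem PreservesForm.col_eq_zero {n : ℕ} {M : Matrix (Fin n ⊕ Unit) (Fin n ⊕ Unit) ℂ}
    (hM : PreservesForm M) {i : Fin n} (h : ∀ r, r ≠ Sum.inl i → M (Sum.inl i) r = 0)
    {r : Fin n ⊕ Unit} (hr : r ≠ Sum.inl i) : M r (Sum.inl i) = 0 := by
  have h1 := congrFun (congrFun hM.mul_conjTranspose r) (Sum.inl i)
  have hne : M (Sum.inl i) (Sum.inl i) ≠ 0 := by
    rw [← norm_ne_zero_iff, hM.norm_diag_eq_one h]
    exact one_ne_zero
  rw [indefI_apply_of_ne hr, mul_indefI_mul_apply, Finset.sum_eq_single (Sum.inl i)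
    (fun t _ ht => by rw [conjTranspose_apply, h t ht]; simp) (by simp)] at h1
  simpa [indefI, hne] using h1

/-- The principal block of `M ∈ U_{n,1}` cut out by `e` is in `U_{m,1}` if the columns of the block
vanish off the block. -/
theorem PreservesForm.submatrix {n m : ℕ} {M : Matrix (Fin n ⊕ Unit) (Fin n ⊕ Unit) ℂ}
    (hM : PreservesForm M) {e : Fin m → Fin n} (he : Function.Injective e)
    (h : ∀ i ∉ Set.range e, ∀ l, M (Sum.inl i) (Sum.map e id l) = 0) :
    PreservesForm (M.submatrix (Sum.map e id) (Sum.map e id)) := by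
  have hinj : Function.Injective (Sum.map e (id : Unit → Unit)) :=
    he.sumMap Function.injective_id
  have hJ : ∀ r s, indefI n (Sum.map e id r) (Sum.map e id s) = indefI m r s := by
    rintro (r | r) (s | s) <;> simp [indefI, Matrix.one_apply, he.eq_iff]
  ext r s
  rw [← hJ, ← hM, mul_indefI_mul_apply, mul_indefI_mul_apply]
  refine Fintype.sum_of_injective _ hinj _ _ ?_ ?_
  · rintro (t | t) ht
    · rw [h t, mul_zero]
      rintro ⟨u, rfl⟩
      exact ht ⟨Sum.inl u, rfl⟩
    · exact absurd ⟨Sum.inr t, rfl⟩ ht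
  · intro t
    rw [hJ]
    rfl

/-- A matrix of `U_{m,1}` becomes an element of `SU_{m,1}` after multiplication by a phase. -/
theorem PreservesForm.exists_smul_mem_SUm1 {m : ℕ} {N : Matrix (Fin m ⊕ Unit) (Fin m ⊕ Unit) ℂ}
    (hN : PreservesForm N) : ∃ μ : ℂ, ‖μ‖ = 1 ∧ μ • N ∈ SUm1 m := by
  -- The matrix has size `m + 1`, so `det (μ • N) = μ ^ (m + 1) * det N`.
  obtain ⟨μ, hμ⟩ := IsAlgClosed.exists_pow_nat_eq (N.det)⁻¹ (Nat.succ_pos m)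
  have hdet := hN.norm_det
  have hμ1 : ‖μ‖ = 1 := by
    refine (pow_eq_one_iff_of_nonneg (norm_nonneg _) (Nat.succ_ne_zero m)).1 ?_
    rw [← norm_pow, hμ, norm_inv, hdet, inv_one]
  refine ⟨μ, hμ1, hN.smul hμ1, ?_⟩
  rw [det_smul]
  simp only [Fintype.card_sum, Fintype.card_fin, Fintype.card_unit]
  rw [hμ, inv_mul_cancel₀]
  rw [← norm_ne_zero_iff, hdet]
  exact one_ne_zero

/-! ### Projection to the first coordinates and the main theorem -/

theorem firstIdx_injective (n k : ℕ) : Function.Injective (firstIdx n k) :=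
  Fin.castLE_injective (Nat.sub_le n k)

theorem mem_range_firstIdx {n k : ℕ} {i : Fin n} : i ∈ Set.range (firstIdx n k) ↔ (i : ℕ) < n - k :=
  ⟨by rintro ⟨j, rfl⟩; exact j.2, fun h => ⟨⟨i, h⟩, rfl⟩⟩

theorem firstCoords_mem_unitBall {n k : ℕ} {z : EuclideanSpace ℂ (Fin n)} (hz : z ∈ unitBall n) :
    firstCoords n k z ∈ unitBall (n - k) := by
  have hz' : ‖z‖ < 1 := by simpa [unitBall] using hz
  have h : ‖firstCoords n k z‖ ^ 2 ≤ ‖z‖ ^ 2 := by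
    rw [EuclideanSpace.norm_sq_eq, EuclideanSpace.norm_sq_eq]
    calc ∑ i, ‖firstCoords n k z i‖ ^ 2
        = ∑ i ∈ Finset.univ.map ⟨_, firstIdx_injective n k⟩, ‖z i‖ ^ 2 := by
          rw [Finset.sum_map]; rfl
      _ ≤ ∑ i, ‖z i‖ ^ 2 :=
          Finset.sum_le_sum_of_subset_of_nonneg (Finset.subset_univ _) fun _ _ _ => by positivity
  have : ‖firstCoords n k z‖ < 1 :=
    (pow_le_pow_iff_left₀ (norm_nonneg _) (norm_nonneg _) two_ne_zero).1 h |>.trans_lt hz'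
  simpa [unitBall] using this

/-- Coordinates are numbered from `0`, so `z_{n-k+1}, …, z_n` are the `z i` with `n - k ≤ i`. -/
theorem lemma2p1 (n k : ℕ) (hk : k ≤ n)
    (F : EuclideanSpace ℂ (Fin n) → EuclideanSpace ℂ (Fin n)) (hF : IsBallAut F)
    (hinv : ∀ i : Fin n, n - k ≤ (i : ℕ) →
      F '' (unitBall n ∩ {z | z i = 0}) ⊆ {z | z i = 0}) :
    ∃ (A : Matrix (Fin (n - k)) (Fin (n - k)) ℂ) (b c : Fin (n - k) → ℂ) (d : ℂ)
      (θ : Fin n → ℝ),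
      bordered A b c d ∈ SUm1 (n - k) ∧
      (∀ z ∈ unitBall n, (∑ l, c l * z (firstIdx n k l)) + d ≠ 0) ∧
      (∀ z ∈ unitBall n, ∀ j : Fin (n - k),
        F z (firstIdx n k j) =
          ((∑ l, A j l * z (firstIdx n k l)) + b j) / ((∑ l, c l * z (firstIdx n k l)) + d)) ∧
      (∀ z ∈ unitBall n, ∀ j : Fin n, n - k ≤ (j : ℕ) →
        F z j = Complex.exp (Complex.I * (θ j : ℂ)) * z j *
          (1 / ((∑ l, c l * z (firstIdx n k l)) + d))) ∧
      (∃ Φ : EuclideanSpace ℂ (Fin (n - k)) → EuclideanSpace ℂ (Fin (n - k)),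
        IsBallAut Φ ∧
        (∀ w ∈ unitBall (n - k), ∀ j : Fin (n - k),
          Φ w j = ((∑ l, A j l * w l) + b j) / ((∑ l, c l * w l) + d)) ∧
        ∀ z ∈ unitBall n, ∀ j : Fin (n - k), F z (firstIdx n k j) = Φ (firstCoords n k z) j) := by
  obtain ⟨M, hM, hFM⟩ := hF.exists_eqOn_linFrac
  have hrow : ∀ i : Fin n, n - k ≤ (i : ℕ) → ∀ r, r ≠ Sum.inl i → M (Sum.inl i) r = 0 :=
    fun i hi r hr => hM.row_eq_zero
      (fun z hz hzi => by rw [← hFM hz]; exact hinv i hi ⟨z, ⟨hz, hzi⟩, rfl⟩) hr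
  have hlt : ∀ i ∉ Set.range (firstIdx n k), n - k ≤ (i : ℕ) := fun i hi => by
    rw [mem_range_firstIdx] at hi
    exact not_lt.1 hi
  set e : Fin (n - k) ⊕ Unit → Fin n ⊕ Unit := Sum.map (firstIdx n k) id
  have hN : PreservesForm (M.submatrix e e) := by
    refine hM.submatrix (firstIdx_injective n k) fun i hi l => hrow i (hlt i hi) _ ?_
    rintro h
    rcases l with l | l
    · exact hi ⟨l, Sum.inl_injective h⟩
    · exact Sum.inr_ne_inl h
  obtain ⟨μ, hμ, hμN⟩ := hN.exists_smul_mem_SUm1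
  have hμ0 : μ ≠ 0 := by
    rw [← norm_ne_zero_iff, hμ]
    exact one_ne_zero
  set P := μ • M.submatrix e e
  have hPform : PreservesForm P := hμN.1
  -- The last `k` columns of `M` vanish in the rows of the block, so these rows see only the first
  -- coordinates of `z`.
  have hPz : ∀ (z : EuclideanSpace ℂ (Fin n)) r,
      (P *ᵥ homog (firstCoords n k z)) r = μ * (M *ᵥ homog z) (e r) := by
    intro z r
    rw [mulVec_homog_apply, mulVec_homog_apply, mul_add, Finset.mul_sum]
    congr 1
    refine Fintype.sum_of_injective _ (firstIdx_injective n k) _ _ ?_ fun l => ?_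
    · intro i hi
      rw [hM.col_eq_zero (hrow i (hlt i hi)), zero_mul, mul_zero]
      rintro h
      rcases r with r | r
      · exact hi ⟨r, Sum.inl_injective h⟩
      · exact Sum.inr_ne_inl h
    · simp [P, e, firstCoords, mul_assoc]
  have hsum : ∀ (z : EuclideanSpace ℂ (Fin n)) r,
      (∑ l, P r (Sum.inl l) * z (firstIdx n k l)) + P r (Sum.inr ()) =
        (P *ᵥ homog (firstCoords n k z)) r := by
    intro z r
    rw [mulVec_homog_apply]
    rfl
  have hfirst : ∀ z ∈ unitBall n, ∀ j, F z (firstIdx n k j) =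
      linFrac P (firstCoords n k z) j := by
    intro z hz j
    rw [hFM hz]
    simp only [linFrac, hPz]
    rw [mul_div_mul_left _ _ hμ0]
    rfl
  -- The phase of `F_j` is `μ * M_jj`: the factor `μ` compensates the rescaling of the denominator.
  -- Values of `θ` at the first `n - k` indices are irrelevant.
  have hphase : ∀ i : Fin n, ∃ θ : ℝ, n - k ≤ (i : ℕ) →
      Complex.exp (Complex.I * θ) = μ * M (Sum.inl i) (Sum.inl i) := by
    intro i
    refine ⟨Complex.arg (μ * M (Sum.inl i) (Sum.inl i)), fun hi => ?_⟩
    have hnorm : ‖μ * M (Sum.inl i) (Sum.inl i)‖ = 1 := by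
      rw [norm_mul, hμ, hM.norm_diag_eq_one (hrow i hi), one_mul]
    have := Complex.norm_mul_exp_arg_mul_I (μ * M (Sum.inl i) (Sum.inl i))
    rwa [hnorm, Complex.ofReal_one, one_mul, mul_comm] at this
  choose θ hθ using hphase
  refine ⟨Matrix.of fun i j => P (Sum.inl i) (Sum.inl j), fun j => P (Sum.inl j) (Sum.inr ()),
    fun l => P (Sum.inr ()) (Sum.inl l), P (Sum.inr ()) (Sum.inr ()), θ, ?_, ?_, ?_, ?_,
    linFrac P, hPform.isBallAut_linFrac, ?_, hfirst⟩
  · convert hμN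
    ext (i | i) (j | j) <;> rfl
  · intro z hz
    rw [hsum]
    exact hPform.denom_ne_zero (firstCoords_mem_unitBall hz)
  · intro z hz j
    simp only [Matrix.of_apply, hsum]
    exact hfirst z hz j
  · intro z hz j hj
    have hnum : (M *ᵥ homog z) (Sum.inl j) = M (Sum.inl j) (Sum.inl j) * z j := by
      rw [mulVec_homog_apply, hrow j hj (Sum.inr ()) (by simp), add_zero,
        Finset.sum_eq_single j _ (by simp)]
      intro l _ hl
      rw [hrow j hj _ (by simpa using hl), zero_mul]
    have hd := hM.denom_ne_zero hz
    rw [hsum, hPz, hθ j hj, hFM hz]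
    change (M *ᵥ homog z) (Sum.inl j) / (M *ᵥ homog z) (Sum.inr ()) =
      _ * (1 / (μ * (M *ᵥ homog z) (Sum.inr ())))
    rw [hnum]
    field_simp
  · intro w _ j
    simp only [Matrix.of_apply, linFrac, mulVec_homog_apply]
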